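/- Let $A$ be a unital $C^*$-algebra, $G$ a discrete group with identity $e$, and $\alpha : G \to \mathrm{Aut}(A)$ a homomorphism into the group of $*$-automorphisms of $A$. Let $A \rtimes_r G$ be the reduced crossed product, i.e. the completion of the $\alpha$-twisted convolution algebra $C_c(G,A)$ in the norm of the regular representation. Concretely, for a faithful unital representation $\pi$ of $A$ on a Hilbert space $H$ (the choice of which is immaterial), it is the norm closure in $B(\ell^2(G,H))$ of the set of finite sums $\sum_g \tilde\pi(a_g)\lambda_g$ with $a_g \in A$, where $(\tilde\pi(a)\xi)(s) = \pi(\alpha_s^{-1}(a))\xi(s)$ and $(\lambda_g\xi)(s) = \xi(g^{-1}s)$; and $A$ is identified with $\tilde\pi(A) \subseteq A \rtimes_r G$. Then the following are equivalent: (i) The inclusion $A \subseteq A \rtimes_r G$ admits a unique conditional expectation, i.e. there is exactly one unital completely positive map $E : A \rtimes_r G \to A$ such that $E(a) = a$ for all $a \in A$. (ii) The relative commutant $A' \cap (A \rtimes_r G) = \{x \in A \rtimes_r G : xa = ax \text{ for all } a \in A\}$ equals the center $Z(A)$ of $A$. (iii) $G$ acts freely on $A$: for every $g \in G$ with $g \neq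 e$, the only $b \in A$ such that $ba = \alpha_g(a)b$ for all $a \in A$ is $b = 0$. -/

import Mathlib

open scoped CStarAlgebra lp ENNReal

noncomputable section

namespace CrossedProduct

universe u v w

section Construction

variable {A : Type u} [CStarAlgebra A] {G : Type v} [Group G]
variable {H : Type w} [NormedAddCommGroup H] [InnerProductSpace ℂ H]

/-- The Hilbert space `ℓ²(G, H)` of square-summable functions from `G` to `H`. -/
abbrev L2 (G : Type v) (H : Type w) [NormedAddCommGroup H] : Type (max v w) :=
  lp (fun _ : G => H) 2

/-- Left translation as an operator: `(λ_g ξ)(s) = ξ(g⁻¹ s)` on `ℓ²(G, H)`. -/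
def translation (H : Type w) [NormedAddCommGroup H] [InnerProductSpace ℂ H]
    (g : G) : L2 G H →L[ℂ] L2 G H :=
  LinearMap.mkContinuous
    { toFun := fun ξ => ⟨fun s => ξ (g⁻¹ * s), by
        have h := (memℓp_gen_iff (p := 2) (by norm_num)).1 (lp.memℓp ξ)
        exact (memℓp_gen_iff (p := 2) (by norm_num)).2
          ((Equiv.mulLeft g⁻¹).summable_iff.2 h)⟩
      map_add' := fun _ _ => by ext; rfl
      map_smul' := fun _ _ => by ext; rfl }
    1 (fun ξ => by
      rw [one_mul, lp.norm_eq_tsum_rpow (p := 2) (by norm_num),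
        lp.norm_eq_tsum_rpow (p := 2) (by norm_num)]
      exact le_of_eq (congrArg (fun r : ℝ => r ^ (1 / (2 : ℝ≥0∞).toReal))
        ((Equiv.mulLeft g⁻¹).tsum_eq (fun s => ‖ξ s‖ ^ (2 : ℝ≥0∞).toReal))))

@[simp] theorem translation_apply (g : G) (ξ : L2 G H) (s : G) :
    translation H g ξ s = ξ (g⁻¹ * s) := rfl

theorem translation_one : translation H (1 : G) = 1 := by
  ext ξ s
  simp

theorem translation_mul (g h : G) :
    translation H (g * h) = translation H g * translation H h := by
  ext ξ s
  simp [mul_assoc]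

variable [CompleteSpace H]

theorem star_translation (g : G) : star (translation H g) = translation H g⁻¹ := by
  rw [ContinuousLinearMap.star_eq_adjoint, eq_comm, ContinuousLinearMap.eq_adjoint_iff]
  intro ξ η
  rw [lp.inner_eq_tsum, lp.inner_eq_tsum,
    ← (Equiv.mulLeft g⁻¹).tsum_eq (fun s => inner ℂ ((translation H g⁻¹ ξ) s) (η s))]
  refine tsum_congr fun s => ?_
  simp

/-- The representation of `A` on `ℓ²(G, H)` induced by an action `α` of `G` on `A` and a
representation `π` of `A` on `H`: `(π̃(a) ξ)(s) = π(α_s⁻¹(a)) ξ(s)`. -/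
def coeffRep (α : G →* (A ≃⋆ₐ[ℂ] A)) (π : A →⋆ₐ[ℂ] (H →L[ℂ] H)) :
    A →⋆ₐ[ℂ] (L2 G H →L[ℂ] L2 G H) where
  toFun a := lp.mapCLM 2 (fun s : G => π (α s⁻¹ a)) (norm_nonneg a) (fun s => by
    calc ‖π (α s⁻¹ a)‖ ≤ ‖α s⁻¹ a‖ := NonUnitalStarAlgHom.norm_apply_le π _
      _ ≤ ‖a‖ := NonUnitalStarAlgHom.norm_apply_le (α s⁻¹) a)
  map_one' := by ext; simp
  map_mul' a b := by ext; simp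
  map_zero' := by ext; simp
  map_add' a b := by ext; simp
  commutes' c := by ext; simp [Algebra.algebraMap_eq_smul_one]
  map_star' a := by
    rw [ContinuousLinearMap.star_eq_adjoint, ContinuousLinearMap.eq_adjoint_iff]
    intro ξ η
    rw [lp.inner_eq_tsum, lp.inner_eq_tsum]
    refine tsum_congr fun s => ?_
    simp [map_star, ContinuousLinearMap.star_eq_adjoint, ContinuousLinearMap.adjoint_inner_left]

@[simp] theorem coeffRep_apply (α : G →* (A ≃⋆ₐ[ℂ] A)) (π : A →⋆ₐ[ℂ] (H →L[ℂ] H))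
    (a : A) (ξ : L2 G H) (s : G) : coeffRep α π a ξ s = π (α s⁻¹ a) (ξ s) := rfl

/-- Covariance: `λ_g π̃(a) = π̃(α_g(a)) λ_g`. -/
theorem translation_mul_coeffRep (α : G →* (A ≃⋆ₐ[ℂ] A)) (π : A →⋆ₐ[ℂ] (H →L[ℂ] H))
    (g : G) (a : A) :
    translation H g * coeffRep α π a = coeffRep α π (α g a) * translation H g := by
  ext ξ s
  have h : α (g⁻¹ * s)⁻¹ a = α s⁻¹ (α g a) := by
    rw [← StarAlgEquiv.mul_apply, ← map_mul, mul_inv_rev, inv_inv]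
  exact congrArg (fun b : A => π b (ξ (g⁻¹ * s))) h

/-- The regular representation of `C_c(G, A)`, which sends a finitely supported function
`f = ∑ f(g) g` to the operator `∑ π̃(f(g)) λ_g` on `ℓ²(G, H)`. -/
def regularRep (α : G →* (A ≃⋆ₐ[ℂ] A)) (π : A →⋆ₐ[ℂ] (H →L[ℂ] H)) :
    (G →₀ A) →ₗ[ℂ] (L2 G H →L[ℂ] L2 G H) :=
  Finsupp.lsum ℂ fun g =>
    (LinearMap.mulRight ℂ (translation H g)).comp (coeffRep α π).toAlgHom.toLinearMap

@[simp] theorem regularRep_single (α : G →* (A ≃⋆ₐ[ℂ] A)) (π : A →⋆ₐ[ℂ] (H →L[ℂ] H))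
    (g : G) (a : A) :
    regularRep α π (Finsupp.single g a) = coeffRep α π a * translation H g := by
  simp [regularRep]

theorem coeffRep_mem_range (α : G →* (A ≃⋆ₐ[ℂ] A)) (π : A →⋆ₐ[ℂ] (H →L[ℂ] H)) (a : A) :
    coeffRep α π a ∈ LinearMap.range (regularRep α π) :=
  ⟨Finsupp.single 1 a, by simp [translation_one]⟩

/-- The image of `C_c(G, A)` under the regular representation, a unital `*`-algebra of operators
on `ℓ²(G, H)`. -/
def regularAlgebra (α : G →* (A ≃⋆ₐ[ℂ] A)) (π : A →⋆ₐ[ℂ] (H →L[ℂ] H)) :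
    StarSubalgebra ℂ (L2 G H →L[ℂ] L2 G H) where
  carrier := LinearMap.range (regularRep α π)
  add_mem' := Submodule.add_mem _
  algebraMap_mem' c := by
    have h := coeffRep_mem_range α π (algebraMap ℂ A c)
    rwa [AlgHomClass.commutes] at h
  mul_mem' := by
    rintro _ _ ⟨f, rfl⟩ ⟨f', rfl⟩
    induction f using Finsupp.induction_linear with
    | zero => simp
    | add x y hx hy => rw [map_add, add_mul]; exact Submodule.add_mem _ hx hy
    | single g a =>
      induction f' using Finsupp.induction_linear with
      | zero => simp
      | add x y hx hy => rw [map_add, mul_add]; exact Submodule.add_mem _ hx hy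
      | single h b =>
        refine ⟨Finsupp.single (g * h) (a * α g b), ?_⟩
        rw [regularRep_single, regularRep_single, regularRep_single, translation_mul, map_mul,
          mul_assoc, mul_assoc, ← mul_assoc (translation H g), translation_mul_coeffRep, mul_assoc]
  star_mem' := by
    rintro _ ⟨f, rfl⟩
    induction f using Finsupp.induction_linear with
    | zero => simp
    | add x y hx hy => rw [map_add, star_add]; exact Submodule.add_mem _ hx hy
    | single g a =>
      refine ⟨Finsupp.single g⁻¹ (α g⁻¹ (star a)), ?_⟩
      rw [regularRep_single, regularRep_single, star_mul, star_translation, ← map_star,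
        translation_mul_coeffRep]

/-- The reduced crossed product `A ⋊_r G`: the completion of `C_c(G, A)` in the norm of the regular
representation, realised as the norm closure of its image in the bounded operators on `ℓ²(G, H)`.
Here `π` is any faithful representation of `A` on a Hilbert space `H`; up to an isomorphism that
fixes `C_c(G, A)`, the algebra does not depend on it. -/
def ReducedCrossedProduct (α : G →* (A ≃⋆ₐ[ℂ] A)) (π : A →⋆ₐ[ℂ] (H →L[ℂ] H)) :
    Type (max v w) :=
  (regularAlgebra α π).topologicalClosure

instance (α : G →* (A ≃⋆ₐ[ℂ] A)) (π : A →⋆ₐ[ℂ] (H →L[ℂ] H)) :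
    CStarAlgebra (ReducedCrossedProduct α π) :=
  haveI : IsClosed ((regularAlgebra α π).topologicalClosure : Set (L2 G H →L[ℂ] L2 G H)) :=
    (regularAlgebra α π).isClosed_topologicalClosure
  inferInstanceAs (CStarAlgebra (regularAlgebra α π).topologicalClosure)

/-- The C*-order: `x ≤ y` iff `y - x` is selfadjoint with spectrum in `[0, ∞)`. -/
instance (α : G →* (A ≃⋆ₐ[ℂ] A)) (π : A →⋆ₐ[ℂ] (H →L[ℂ] H)) :
    PartialOrder (ReducedCrossedProduct α π) :=
  CStarAlgebra.spectralOrder _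

instance (α : G →* (A ≃⋆ₐ[ℂ] A)) (π : A →⋆ₐ[ℂ] (H →L[ℂ] H)) :
    StarOrderedRing (ReducedCrossedProduct α π) :=
  CStarAlgebra.spectralOrderedRing _

/-- The canonical unital `*`-homomorphism `A → A ⋊_r G`, `a ↦ π̃(a)`. -/
def inclusion (α : G →* (A ≃⋆ₐ[ℂ] A)) (π : A →⋆ₐ[ℂ] (H →L[ℂ] H)) :
    A →⋆ₐ[ℂ] ReducedCrossedProduct α π :=
  (coeffRep α π).codRestrict (regularAlgebra α π).topologicalClosure
    (fun a => subset_closure (coeffRep_mem_range α π a))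

end Construction

/-- A conditional expectation for a C*-inclusion `ι : A → B`: a unital completely positive map
`E : B → A` that restricts to the identity on `A`. -/
structure IsConditionalExpectation {A : Type u} {B : Type v}
    [CStarAlgebra A] [PartialOrder A] [StarOrderedRing A]
    [CStarAlgebra B] [PartialOrder B] [StarOrderedRing B]
    (ι : A →⋆ₐ[ℂ] B) (E : B →CP A) : Prop where
  map_one : E 1 = 1
  map_inclusion : ∀ a : A, E (ι a) = a

/-- `b` is a dependent element for the automorphism `φ` if `b a = φ(a) b` for all `a`. -/
def IsDependentElement {A : Type u} [CStarAlgebra A] (φ : A ≃⋆ₐ[ℂ] A) (b : A) : Prop :=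
  ∀ a : A, b * a = φ a * b

/-- `G` acts freely on `A` through `α` if, for `g ≠ e`, the only dependent element for `α_g`
is zero. -/
def ActsFreely {A : Type u} [CStarAlgebra A] {G : Type v} [Group G]
    (α : G →* (A ≃⋆ₐ[ℂ] A)) : Prop :=
  ∀ g : G, g ≠ 1 → ∀ b : A, IsDependentElement (α g) b → b = 0

end CrossedProduct

end

/-! The coefficient at the identity of `G` is a faithful conditional expectation, so uniqueness
means that every expectation `E` agrees with it. (iii) → (i): `A` lies in the multiplicative domain
of `E` (`IsConditionalExpectation.bimodule`), so covariance makes `E(u_g)` a dependent element for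
`α_g`. Freeness kills it for `g ≠ 1`, and the monomials `a u_g` span a dense subspace. (i) → (ii):
if `y` commutes with `A` and `‖y‖ ≤ 1`, then `E(y* · y)` plus a central correction is again an
expectation. Uniqueness gives `E(y* x y) = E(x) E(y* y)` (`map_conj_of_unique`). Polarising this at
`z = E(x) - x`, for `x` in the relative commutant, yields `E(z z*) = 0`, and faithfulness gives `z =
0`. (ii) → (iii): a dependent element `b` for `α_g` gives `u_g⁻¹ b` in the relative commutant, hence
in `A`; for `g ≠ 1` its coefficient at the identity is zero, so `b = 0`. -/

noncomputable section

namespace CrossedProduct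

universe u v w

/-! ### Positivity in C*-algebras and their matrix algebras -/

section Positivity

variable {A : Type u} [NonUnitalCStarAlgebra A] [PartialOrder A] [StarOrderedRing A]
variable {B : Type v} [NonUnitalCStarAlgebra B] [PartialOrder B] [StarOrderedRing B]

/-- An injective `*`-homomorphism reflects positivity. -/
theorem nonneg_of_map_nonneg (φ : A →⋆ₙₐ[ℂ] B) (hφ : Function.Injective φ) {a : A}
    (h : 0 ≤ φ a) : 0 ≤ a := by
  have hsa : IsSelfAdjoint a := hφ (by rw [map_star, (IsSelfAdjoint.of_nonneg h).star_eq])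
  -- Functional calculus commutes with `φ`, so `φ(a⁻) = φ(a)⁻ = 0`.
  rw [← CFC.negPart_eq_zero_iff a hsa]
  apply hφ
  have h2 : (φ a)⁻ = 0 := (CFC.negPart_eq_zero_iff _ (IsSelfAdjoint.of_nonneg h)).2 h
  rw [map_zero, ← h2, CFC.negPart_def, CFC.negPart_def]
  exact NonUnitalStarAlgHomClass.map_cfcₙ (R := ℝ) (S := ℂ) φ _ a
    (hφ := map_continuous φ)

theorem exists_eq_star_mul_self {a : A} (ha : 0 ≤ a) : ∃ b : A, a = star b * b :=
  CStarAlgebra.nonneg_iff_eq_star_mul_self.1 ha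

/-- Positive matrices are positive as quadratic forms. -/
theorem cstarMatrix_sum_nonneg {n : Type w} [Fintype n] {M : CStarMatrix n n A} (hM : 0 ≤ M)
    (v : n → A) : 0 ≤ ∑ i, ∑ j, star (v i) * M i j * v j := by
  obtain ⟨N, rfl⟩ := exists_eq_star_mul_self hM
  have h : ∑ i, ∑ j, star (v i) * (star N * N) i j * v j =
      ∑ l, star (∑ i, N l i * v i) * ∑ j, N l j * v j := by
    simp only [CStarMatrix.mul_apply, CStarMatrix.star_apply, star_sum, star_mul,
      Finset.sum_mul, Finset.mul_sum, mul_assoc]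
    rw [Finset.sum_comm_cycle]
    exact Finset.sum_congr rfl fun _ _ => Finset.sum_comm
  rw [h]
  exact Finset.sum_nonneg fun l _ => star_mul_self_nonneg _

/-- Conjugating every entry of a positive matrix by a fixed element gives a positive matrix. -/
theorem cstarMatrix_conj_nonneg {n : Type w} [Fintype n] {M : CStarMatrix n n A} (hM : 0 ≤ M)
    (c : A) : 0 ≤ M.map (fun x => star c * x * c) := by
  classical
  let D : CStarMatrix n n A := CStarMatrix.ofMatrix (Matrix.diagonal fun _ => c)
  have h : M.map (fun x => star c * x * c) = star D * M * D := by
    ext i j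
    simp [D, CStarMatrix.mul_apply, CStarMatrix.star_apply, Matrix.diagonal_apply, apply_ite star]
  rw [h]
  exact star_left_conjugate_nonneg hM D

/-- If `d + r w` is positive for all `r > 0`, then so is `w`. -/
theorem nonneg_of_forall_add_smul_nonneg {d w : A} (h : ∀ r : ℝ, 0 < r → 0 ≤ d + r • w) :
    0 ≤ w := by
  -- Divide by `r` and let `r → ∞`; the positive cone is closed.
  have ht : Filter.Tendsto (fun r : ℝ => r⁻¹ • d + w) Filter.atTop (nhds w) := by
    simpa using ((tendsto_inv_atTop_zero (𝕜 := ℝ)).smul_const d).add_const w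
  refine CStarAlgebra.isClosed_nonneg.mem_of_tendsto ht ?_
  filter_upwards [Filter.eventually_gt_atTop 0] with r hr
  have h2 : r⁻¹ • d + w = r⁻¹ • (d + r • w) := by
    rw [smul_add, smul_smul, inv_mul_cancel₀ hr.ne', one_smul]
  change 0 ≤ r⁻¹ • d + w
  rw [h2]
  exact smul_nonneg (inv_nonneg.2 hr.le) (h r hr)

end Positivity

/-! ### Abstract conditional expectations and consequences of uniqueness -/

section Expectation

theorem star_mem_centralizer_range {A : Type u} [CStarAlgebra A] {B : Type v} [CStarAlgebra B]
    {ι : A →⋆ₐ[ℂ] B} {y : B}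
    (hy : y ∈ Set.centralizer (Set.range ι)) : star y ∈ Set.centralizer (Set.range ι) := by
  rintro _ ⟨a, rfl⟩
  have h := congrArg star (hy (ι (star a)) ⟨_, rfl⟩)
  simpa [map_star] using h.symm

variable {A : Type u} [CStarAlgebra A] [PartialOrder A] [StarOrderedRing A]
variable {B : Type v} [CStarAlgebra B] [PartialOrder B] [StarOrderedRing B]

/-- The Kadison–Schwarz inequality for unital completely positive maps. -/
theorem schwarz_nonneg (E : B →CP A) (h1 : E 1 = 1) (x : B) :
    0 ≤ E (star x * x) - E (star x) * E x := by
  -- `N* N` has rows `(x* x, x*)` and `(x, 1)`; the vector `(1, -E x)` completes the square.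
  let N : CStarMatrix (Fin 2) (Fin 2) B := CStarMatrix.ofMatrix !![x, 1; 0, 0]
  have h := cstarMatrix_sum_nonneg
    (E.map_cstarMatrix_nonneg (star N * N) (star_mul_self_nonneg N)) ![1, -E x]
  have e : ∀ i j, (star N * N) i j = star (N 0 i) * N 0 j + star (N 1 i) * N 1 j := fun i j => by
    simp [CStarMatrix.mul_apply, CStarMatrix.star_apply]
  have e00 : N 0 0 = x := rfl
  have e01 : N 0 1 = 1 := rfl
  have e10 : N 1 0 = 0 := rfl
  have e11 : N 1 1 = 0 := rfl
  simpa [Fin.sum_univ_two, CStarMatrix.map_apply, e, e00, e01, e10, e11, h1, sub_eq_add_neg]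
    using h

/-- The expression is odd in `t`, so positivity at both `t` and `-t` makes it vanish; `t = 1` and `t
= i` then separate `p` from `q`. -/
theorem eq_zero_of_forall_nonneg {p q : A} (h : ∀ t : ℂ, 0 ≤ star t • p + t • q) :
    p = 0 ∧ q = 0 := by
  have h1 := h 1
  have h2 := h (-1)
  have h3 := h Complex.I
  have h4 := h (-Complex.I)
  simp only [star_one, one_smul, star_neg, neg_smul, RCLike.star_def, Complex.conj_I,
    neg_neg] at h1 h2 h3 h4
  have e1 : p + q = 0 := le_antisymm (by rw [← neg_nonneg, neg_add]; exact h2) h1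
  have e2 : -(Complex.I • p) + Complex.I • q = 0 :=
    le_antisymm (by rw [← neg_nonneg, neg_add, neg_neg]; exact h4) h3
  have e3 : p = q := by
    have : Complex.I • (q - p) = 0 := by rw [smul_sub, ← e2]; abel
    exact (sub_eq_zero.1 ((smul_eq_zero.1 this).resolve_left Complex.I_ne_zero)).symm
  subst e3
  have : (2 : ℂ) • p = 0 := by rw [two_smul, e1]
  have := (smul_eq_zero.1 this).resolve_left two_ne_zero
  exact ⟨this, this⟩

/-- The image of `ι` lies in the multiplicative domain of a conditional expectation. -/
theorem IsConditionalExpectation.bimodule {ι : A →⋆ₐ[ℂ] B} {E : B →CP A}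
    (hE : IsConditionalExpectation ι E) (a : A) (x : B) :
    E (ι (star a) * x) = star a * E x ∧ E (star x * ι a) = E (star x) * a := by
  have key : ∀ t : ℂ, 0 ≤ star t • (E (ι (star a) * x) - star a * E x) +
      t • (E (star x * ι a) - E (star x) * a) := fun t => by
    -- The Schwarz defect of `x + r t ι(a)` is affine in `r`: its quadratic term cancels because
    -- `E(ι(a* a)) = a* a`. Here `d` is its value at `r = 0`.
    refine nonneg_of_forall_add_smul_nonneg (d := E (star x * x) - E (star x) * E x) fun r _ => ?_
    have h := schwarz_nonneg E hE.map_one (x + ((r : ℂ) * t) • ι a)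
    convert h using 1
    simp only [star_add, star_smul, add_mul, mul_add, map_add, map_smul, smul_mul_assoc,
      mul_smul_comm, ← map_star ι, hE.map_inclusion, ← map_mul ι, star_mul']
    simp only [← Complex.coe_smul, RCLike.star_def, Complex.conj_ofReal]
    module
  obtain ⟨h1, h2⟩ := eq_zero_of_forall_nonneg key
  exact ⟨sub_eq_zero.1 h1, sub_eq_zero.1 h2⟩

theorem IsConditionalExpectation.map_inclusion_mul {ι : A →⋆ₐ[ℂ] B} {E : B →CP A}
    (hE : IsConditionalExpectation ι E) (a : A) (x : B) : E (ι a * x) = a * E x := by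
  simpa using (hE.bimodule (star a) x).1

theorem IsConditionalExpectation.map_mul_inclusion {ι : A →⋆ₐ[ℂ] B} {E : B →CP A}
    (hE : IsConditionalExpectation ι E) (a : A) (x : B) : E (x * ι a) = E x * a := by
  simpa using (hE.bimodule a (star x)).2

theorem IsConditionalExpectation.map_mem_center {ι : A →⋆ₐ[ℂ] B} {E : B →CP A}
    (hE : IsConditionalExpectation ι E) {x : B} (hx : x ∈ Set.centralizer (Set.range ι)) :
    E x ∈ Set.center A := by
  refine Semigroup.mem_center_iff.2 fun a => ?_
  rw [← hE.map_inclusion_mul, ← hE.map_mul_inclusion, hx (ι a) ⟨a, rfl⟩]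

/-- The completely positive map `x ↦ E(y* x y) + s* E(x) s`. -/
def perturbation (E : B →CP A) (y : B) (s : A) : B →CP A where
  toLinearMap := (E : B →ₗ[ℂ] A) ∘ₗ LinearMap.mulLeft ℂ (star y) ∘ₗ LinearMap.mulRight ℂ y +
    LinearMap.mulLeft ℂ (star s) ∘ₗ LinearMap.mulRight ℂ s ∘ₗ (E : B →ₗ[ℂ] A)
  map_cstarMatrix_nonneg' k M hM := by
    convert add_nonneg (E.map_cstarMatrix_nonneg _ (cstarMatrix_conj_nonneg hM y))
      (cstarMatrix_conj_nonneg (E.map_cstarMatrix_nonneg _ hM) s) using 1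
    ext i j
    simp [CStarMatrix.map_apply, mul_assoc]

theorem perturbation_apply (E : B →CP A) (y : B) (s : A) (x : B) :
    perturbation E y s x = E (star y * (x * y)) + star s * (E x * s) := rfl

/-- A unique conditional expectation scales under conjugation by elements of the relative
commutant. -/
theorem map_conj_of_unique {ι : A →⋆ₐ[ℂ] B} {E : B →CP A} (hE : IsConditionalExpectation ι E)
    (huniq : ∀ F : B →CP A, IsConditionalExpectation ι F → F = E) {y : B}
    (hy : y ∈ Set.centralizer (Set.range ι)) (x : B) :
    E (star y * (x * y)) = E x * E (star y * y) := by
  have main : ∀ y ∈ Set.centralizer (Set.range ι), ‖y‖ ≤ 1 →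
      E (star y * (x * y)) = E x * E (star y * y) := by
    intro y hy hn
    have hyy : star y * y ∈ Set.centralizer (Set.range ι) :=
      Set.mul_mem_centralizer (star_mem_centralizer_range hy) hy
    set c := E (star y * y) with hc
    have hcc : c ∈ Set.center A := hE.map_mem_center hyy
    have hc1 : 0 ≤ 1 - c := by
      have h1 : star y * y ≤ 1 := by
        refine (CStarAlgebra.norm_le_one_iff_of_nonneg _ (star_mul_self_nonneg y)).1 ?_
        rw [CStarRing.norm_star_mul_self]
        nlinarith [norm_nonneg y]
      have := OrderHomClass.mono E h1
      rw [hE.map_one] at this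
      exact sub_nonneg.2 this
    set s := CFC.sqrt (1 - c) with hs
    have hss : star s = s := (IsSelfAdjoint.of_nonneg (CFC.sqrt_nonneg _)).star_eq
    have hs2 : s * s = 1 - c := CFC.sqrt_mul_sqrt_self _ hc1
    have hsc : ∀ a, a * s = s * a := fun a => by
      have h : Commute (1 - c) a :=
        (Commute.one_left a).sub_left (Semigroup.mem_center_iff.1 hcc a).symm
      exact (h.cfcₙ_nnreal NNReal.sqrt).symm
    have hF : ∀ x, perturbation E y s x = E (star y * (x * y)) + E x * (1 - c) := fun x => by
      rw [perturbation_apply, hss, ← hsc, mul_assoc, hs2]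
    have hF' : IsConditionalExpectation ι (perturbation E y s) := by
      have h : ∀ a, perturbation E y s (ι a) = a := fun a => by
        rw [hF, hE.map_inclusion, ← mul_assoc, ← star_mem_centralizer_range hy (ι a) ⟨a, rfl⟩,
          mul_assoc, hE.map_inclusion_mul]
        noncomm_ring
      exact ⟨by rw [← map_one ι, h], h⟩
    have h := DFunLike.congr_fun (huniq _ hF') x
    rw [hF, mul_sub, mul_one] at h
    exact sub_eq_zero.1 (by rw [← sub_eq_zero.2 h]; abel)
  -- Both sides are quadratic in `y`, so `y` may be rescaled into the unit ball; the `+ 1` covers `y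
  -- = 0`.
  have h0 : (0 : ℝ) < ‖y‖ + 1 := by positivity
  have hr : ((‖y‖ + 1 : ℝ) : ℂ) ≠ 0 := by exact_mod_cast h0.ne'
  have h := main ((((‖y‖ + 1 : ℝ) : ℂ)⁻¹) • y) (by
    intro b hb
    rw [mul_smul_comm, smul_mul_assoc, hy b hb]) (by
    rw [norm_smul, norm_inv, Complex.norm_real, Real.norm_of_nonneg h0.le, inv_mul_le_iff₀ h0]
    linarith)
  simpa [star_smul, hr, -Complex.ofReal_add] using h

/-- A faithful unique conditional expectation forces the relative commutant to be the centre. -/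
theorem centralizer_eq_of_unique {ι : A →⋆ₐ[ℂ] B} {E : B →CP A}
    (hE : IsConditionalExpectation ι E)
    (huniq : ∀ F : B →CP A, IsConditionalExpectation ι F → F = E)
    (hfaith : ∀ x, E (star x * x) = 0 → x = 0) :
    Set.centralizer (Set.range ι) = ι '' Set.center A := by
  apply Set.Subset.antisymm
  · intro x hx
    have hc := hE.map_mem_center hx
    refine ⟨E x, hc, ?_⟩
    have hι : ∀ a ∈ Set.center A, ι a ∈ Set.centralizer (Set.range ι) := by
      rintro a ha _ ⟨b, rfl⟩
      rw [← map_mul, ← map_mul, Semigroup.mem_center_iff.1 ha b]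
    have hz : ι (E x) - x ∈ Set.centralizer (Set.range ι) := by
      intro b hb
      rw [mul_sub, sub_mul, hι _ hc b hb, hx b hb]
    set z := ι (E x) - x with hzdef
    have hz0 : E z = 0 := by rw [hzdef, map_sub, hE.map_inclusion, sub_self]
    -- Since `E z = 0`, conjugating `z` by any element of the relative commutant gives expectation
    -- zero. Expanding in `t` isolates `E(z z*)`, once `k0` removes the `|t|²` term.
    have key : ∀ t : ℂ, E (star (1 + t • star z) * (z * (1 + t • star z))) = 0 := fun t => by
      rw [map_conj_of_unique hE huniq, hz0, zero_mul]
      intro b hb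
      rw [mul_add, add_mul, mul_smul_comm, smul_mul_assoc,
        star_mem_centralizer_range hz b hb, mul_one, one_mul]
    have k0 : E (z * (z * star z)) = 0 := by
      have := map_conj_of_unique hE huniq (star_mem_centralizer_range hz) z
      rwa [hz0, zero_mul, star_star] at this
    have k : ∀ t : ℂ, t • E (z * star z) + star t • E (z * z) = 0 := fun t => by
      have := key t
      simp only [star_add, star_one, star_smul, star_star, add_mul, mul_add, one_mul, mul_one,
        map_add, map_smul, smul_mul_assoc, mul_smul_comm, hz0, k0, smul_zero, add_zero,
        zero_add] at this
      rw [← this, add_comm]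
    have h1 := eq_zero_of_forall_nonneg (p := E (z * z)) (q := E (z * star z))
      (fun t => by rw [add_comm, k])
    have := hfaith (star z) (by rw [star_star, h1.2])
    exact sub_eq_zero.1 (star_eq_zero.1 this)
  · rintro _ ⟨a, ha, rfl⟩ _ ⟨b, rfl⟩
    rw [← map_mul, ← map_mul, Semigroup.mem_center_iff.1 ha b]

end Expectation

/-! ### Corner embeddings of operator algebras -/

section Corner

variable {K : Type v} [NormedAddCommGroup K] [InnerProductSpace ℂ K] [CompleteSpace K]
variable {H : Type w} [NormedAddCommGroup H] [InnerProductSpace ℂ H] [CompleteSpace H]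

/-- Conjugation by an isometry `V`, the corner embedding `T ↦ V T V*`. -/
def cornerEmbedding (V : H →L[ℂ] K) (hV : V.adjoint ∘L V = 1) :
    (H →L[ℂ] H) →⋆ₙₐ[ℂ] (K →L[ℂ] K) where
  toFun T := V ∘L T ∘L V.adjoint
  map_smul' c T := by ext; simp
  map_zero' := by ext; simp
  map_add' S T := by ext; simp
  map_mul' S T := by
    ext x
    have h : ∀ y, V.adjoint (V y) = y := fun y => DFunLike.congr_fun hV y
    simp [h]
  map_star' T := by
    simp [ContinuousLinearMap.star_eq_adjoint, ContinuousLinearMap.adjoint_comp,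
      ContinuousLinearMap.comp_assoc]

theorem cornerEmbedding_injective (V : H →L[ℂ] K) (hV : V.adjoint ∘L V = 1) :
    Function.Injective (cornerEmbedding V hV) := by
  intro S T h
  have h' : ∀ y, V.adjoint (V y) = y := fun y => DFunLike.congr_fun hV y
  ext x
  have := congrArg V.adjoint (DFunLike.congr_fun h (V x))
  simpa [cornerEmbedding, h'] using this

end Corner

/-! ### Coordinates and diagonal entries on `ℓ²(G, H)` -/

section Single

variable {G : Type v} {H : Type w} [NormedAddCommGroup H] [InnerProductSpace ℂ H]

open Classical in
/-- The isometric embedding of `H` as the coordinate `s` of `ℓ²(G, H)`. -/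
def coordinate (H : Type w) [NormedAddCommGroup H] [InnerProductSpace ℂ H] (s : G) :
    H →L[ℂ] L2 G H :=
  lp.singleContinuousLinearMap ℂ (fun _ : G => H) 2 s

open Classical in
theorem coordinate_apply (s : G) (h : H) (t : G) :
    coordinate H s h t = if t = s then h else 0 := by
  rw [coordinate, lp.singleContinuousLinearMap_apply, lp.single_apply]
  by_cases hts : t = s
  · subst hts; simp
  · simp [hts]

theorem translation_coordinate [Group G] (g s : G) (h : H) :
    translation H g (coordinate H s h) = coordinate H (g * s) h := by
  ext t
  rw [translation_apply, coordinate_apply, coordinate_apply, inv_mul_eq_iff_eq_mul]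

/-- Operators on `ℓ²(G, H)` agreeing on all coordinate vectors are equal. -/
theorem ext_coordinate {S T : L2 G H →L[ℂ] L2 G H}
    (h : ∀ s x, S (coordinate H s x) = T (coordinate H s x)) : S = T := by
  classical
  have h' : ∀ s x, S (lp.single 2 s x) = T (lp.single 2 s x) := h
  ext1 ξ
  have hs := lp.hasSum_single (p := 2) (by simp) ξ
  exact (hs.mapL S).unique (by simpa only [h'] using hs.mapL T)

variable [CompleteSpace H]

theorem adjoint_coordinate_apply (s : G) (ξ : L2 G H) :
    (coordinate H s).adjoint ξ = ξ s := by
  classical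
  refine ext_inner_left ℂ fun h => ?_
  rw [ContinuousLinearMap.adjoint_inner_right]
  exact lp.inner_single_left (𝕜 := ℂ) (G := fun _ : G => H) s h ξ

theorem adjoint_coordinate_comp (s : G) :
    (coordinate H s).adjoint ∘L coordinate H s = 1 := by
  ext h
  simp [adjoint_coordinate_apply, coordinate_apply]

/-- The diagonal entry at `s` of an operator on `ℓ²(G, H)`. -/
def diagonalEntry (s : G) : (L2 G H →L[ℂ] L2 G H) →L[ℂ] (H →L[ℂ] H) :=
  (ContinuousLinearMap.compL ℂ H (L2 G H) H (coordinate H s).adjoint) ∘L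
    (ContinuousLinearMap.compL ℂ H (L2 G H) (L2 G H)).flip (coordinate H s)

theorem diagonalEntry_apply (s : G) (T : L2 G H →L[ℂ] L2 G H) (h : H) :
    diagonalEntry s T h = T (coordinate H s h) s :=
  adjoint_coordinate_apply s _

end Single

/-! ### The reduced crossed product, its canonical expectation and freeness -/

section Construction

variable {A : Type u} [CStarAlgebra A] {G : Type v} [Group G]
variable {H : Type w} [NormedAddCommGroup H] [InnerProductSpace ℂ H] [CompleteSpace H]
variable (α : G →* (A ≃⋆ₐ[ℂ] A)) (π : A →⋆ₐ[ℂ] (H →L[ℂ] H))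

/-- The defining representation of the reduced crossed product on `ℓ²(G, H)`. -/
def toOperator : ReducedCrossedProduct α π →⋆ₐ[ℂ] (L2 G H →L[ℂ] L2 G H) :=
  (regularAlgebra α π).topologicalClosure.subtype

theorem toOperator_injective : Function.Injective (toOperator α π) :=
  Subtype.val_injective

theorem continuous_toOperator : Continuous (toOperator α π) :=
  continuous_subtype_val

theorem toOperator_inclusion (a : A) : toOperator α π (inclusion α π a) = coeffRep α π a := rfl

/-- The canonical unitary of the reduced crossed product implementing `α g`. -/
def canonicalUnitary (g : G) : ReducedCrossedProduct α π :=
  ⟨translation H g, subset_closure ⟨Finsupp.single g 1, by simp⟩⟩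

theorem toOperator_canonicalUnitary (g : G) :
    toOperator α π (canonicalUnitary α π g) = translation H g := rfl

theorem canonicalUnitary_one : canonicalUnitary α π 1 = 1 :=
  toOperator_injective α π (by
    rw [toOperator_canonicalUnitary, translation_one, map_one])

theorem canonicalUnitary_inv_mul (g : G) :
    canonicalUnitary α π g⁻¹ * canonicalUnitary α π g = 1 :=
  toOperator_injective α π (by
    rw [map_mul, toOperator_canonicalUnitary, toOperator_canonicalUnitary, ← translation_mul,
      inv_mul_cancel, translation_one, map_one])

theorem canonicalUnitary_mul_inclusion (g : G) (a : A) :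
    canonicalUnitary α π g * inclusion α π a =
      inclusion α π (α g a) * canonicalUnitary α π g :=
  toOperator_injective α π (by
    rw [map_mul, map_mul, toOperator_canonicalUnitary, toOperator_inclusion, toOperator_inclusion,
      translation_mul_coeffRep])

variable {α π}

/-- A closed condition that is additive and holds on monomials `a u_g` holds everywhere. -/
theorem crossedProduct_induction {p : ReducedCrossedProduct α π → Prop}
    (hclosed : IsClosed {x | p x}) (hzero : p 0) (hadd : ∀ x y, p x → p y → p (x + y))
    (hmono : ∀ g a, p (inclusion α π a * canonicalUnitary α π g)) (x) : p x := by
  have key : ∀ f : G →₀ A, ∃ y : ReducedCrossedProduct α π,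
      toOperator α π y = regularRep α π f ∧ p y := by
    intro f
    induction f using Finsupp.induction_linear with
    | zero => exact ⟨0, by rw [map_zero, map_zero], hzero⟩
    | add f f' hf hf' =>
      obtain ⟨y, hy, hpy⟩ := hf
      obtain ⟨y', hy', hpy'⟩ := hf'
      exact ⟨y + y', by rw [map_add, map_add, hy, hy'], hadd _ _ hpy hpy'⟩
    | single g a => exact ⟨_, by
        rw [map_mul, toOperator_canonicalUnitary, toOperator_inclusion, regularRep_single],
        hmono g a⟩
  have hdense : Dense {x : ReducedCrossedProduct α π | p x} := by
    have hind : Topology.IsInducing (toOperator α π) := Topology.IsInducing.subtypeVal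
    rw [hind.dense_iff]
    intro x
    refine closure_mono ?_ (show toOperator α π x ∈ closure _ from x.2)
    rintro _ ⟨f, rfl⟩
    obtain ⟨y, hy, hpy⟩ := key f
    exact ⟨y, hpy, hy⟩
  exact hclosed.closure_subset (hdense x)

-- The monomial `a u_g` sends coordinate `s` to coordinate `g s`, so it meets the diagonal only when
-- `g = 1`.
open Classical in
theorem diagonalEntry_monomial (s g : G) (a : A) :
    diagonalEntry s (toOperator α π (inclusion α π a * canonicalUnitary α π g)) =
      if g = 1 then π (α s⁻¹ a) else 0 := by
  ext h
  rw [diagonalEntry_apply, map_mul, toOperator_canonicalUnitary, toOperator_inclusion,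
    mul_apply_eq_comp, translation_coordinate, coeffRep_apply, coordinate_apply]
  by_cases hg : g = 1 <;> simp [hg]

/-- A faithful `π` is isometric, so its range is closed and the claim passes from monomials to
limits. -/
theorem exists_coefficient (hπ : Function.Injective π) (x : ReducedCrossedProduct α π) :
    ∃ a, π a = diagonalEntry 1 (toOperator α π x) := by
  classical
  have hiso : Isometry π := NonUnitalStarAlgHom.isometry π hπ
  refine crossedProduct_induction (p := fun x => ∃ a, π a = diagonalEntry 1 (toOperator α π x))
    ?_ ⟨0, by simp⟩ ?_ ?_ x
  · exact hiso.isClosedEmbedding.isClosed_range.preimage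
      ((diagonalEntry 1).continuous.comp (continuous_toOperator α π))
  · rintro x y ⟨a, ha⟩ ⟨b, hb⟩
    exact ⟨a + b, by simp only [map_add, ha, hb]⟩
  · intro g a
    rw [diagonalEntry_monomial]
    by_cases hg : g = 1
    · exact ⟨a, by simp [hg]⟩
    · exact ⟨0, by simp [hg]⟩

/-- The coefficient of `x` at the identity of `G`, as a linear map. -/
def coefficient (hπ : Function.Injective π) : ReducedCrossedProduct α π →ₗ[ℂ] A where
  toFun x := (exists_coefficient hπ x).choose
  map_add' x y := hπ (by
    rw [map_add π, (exists_coefficient hπ x).choose_spec, (exists_coefficient hπ y).choose_spec,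
      (exists_coefficient hπ (x + y)).choose_spec, map_add, map_add])
  map_smul' c x := hπ (by
    rw [RingHom.id_apply, map_smul π, (exists_coefficient hπ x).choose_spec,
      (exists_coefficient hπ (c • x)).choose_spec, map_smul, map_smul])

theorem map_coefficient (hπ : Function.Injective π) (x : ReducedCrossedProduct α π) :
    π (coefficient hπ x) = diagonalEntry 1 (toOperator α π x) :=
  (exists_coefficient hπ x).choose_spec

variable [PartialOrder A] [StarOrderedRing A]

/-- The canonical conditional expectation of the reduced crossed product onto `A`. -/
def canonicalExpectation (hπ : Function.Injective π) : ReducedCrossedProduct α π →CP A where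
  toLinearMap := coefficient hπ
  map_cstarMatrix_nonneg' k M hM := by
    let V := coordinate H (1 : G)
    -- Positivity is tested after the injective map `θ(a) = V π(a) V*`: there `θ` of the coefficient
    -- of `x` is the compression of `x` by the projection `V V*`, so everything stays inside
    -- operators on `ℓ²(G, H)`.
    let θ := (cornerEmbedding V (adjoint_coordinate_comp 1)).comp (π : A →⋆ₙₐ[ℂ] (H →L[ℂ] H))
    have hθ : Function.Injective θ := 
      (cornerEmbedding_injective V (adjoint_coordinate_comp 1)).comp hπ
    refine nonneg_of_map_nonneg (CStarMatrix.mapₙₐ θ) (fun N N' h => ?_) ?_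
    · ext i j
      exact hθ (congrFun (congrFun h i) j)
    · have h1 : 0 ≤ M.map (toOperator α π) :=
        CompletelyPositiveMapClass.map_cstarMatrix_nonneg' (toOperator α π) k M hM
      have h2 := cstarMatrix_conj_nonneg h1 (V ∘L V.adjoint)
      convert h2 using 1
      refine CStarMatrix.ext fun i j => ?_
      change V ∘L (π (coefficient hπ (M i j))) ∘L V.adjoint = _
      rw [map_coefficient]
      simp only [CStarMatrix.map_apply, ContinuousLinearMap.star_eq_adjoint,
        ContinuousLinearMap.adjoint_comp, ContinuousLinearMap.adjoint_adjoint]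
      rfl

theorem map_canonicalExpectation (hπ : Function.Injective π) (x : ReducedCrossedProduct α π) :
    π (canonicalExpectation hπ x) = diagonalEntry 1 (toOperator α π x) :=
  map_coefficient hπ x

open Classical in
theorem canonicalExpectation_monomial (hπ : Function.Injective π) (g : G) (a : A) :
    canonicalExpectation hπ (inclusion α π a * canonicalUnitary α π g) =
      if g = 1 then a else 0 := by
  apply hπ
  rw [map_canonicalExpectation, diagonalEntry_monomial]
  by_cases hg : g = 1 <;> simp [hg]

theorem isConditionalExpectation_canonicalExpectation (hπ : Function.Injective π) :
    IsConditionalExpectation (inclusion α π) (canonicalExpectation hπ) := by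
  classical
  have h : ∀ a, canonicalExpectation hπ (inclusion α π a) = a := fun a => by
    have := canonicalExpectation_monomial (α := α) hπ 1 a
    rwa [canonicalUnitary_one, mul_one, if_pos rfl] at this
  exact ⟨by rw [← map_one (inclusion α π), h], h⟩

/-- The diagonal of an element of the crossed product is determined by its expectation. -/
theorem diagonalEntry_eq (hπ : Function.Injective π) (s : G) (x : ReducedCrossedProduct α π) :
    diagonalEntry s (toOperator α π x) = π (α s⁻¹ (canonicalExpectation hπ x)) := by
  classical
  have hc : Continuous (canonicalExpectation (α := α) hπ) := map_continuous _
  have hα : Continuous (α s⁻¹) :=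
    (NonUnitalStarAlgHom.isometry (α s⁻¹) (α s⁻¹).injective).continuous
  refine crossedProduct_induction
    (p := fun x => diagonalEntry s (toOperator α π x) = π (α s⁻¹ (canonicalExpectation hπ x)))
    (isClosed_eq ((diagonalEntry s).continuous.comp (continuous_toOperator α π))
      ((map_continuous π).comp (hα.comp hc))) (by simp only [map_zero])
    (fun x y hx hy => by simp only [map_add, hx, hy]) (fun g a => ?_) x
  rw [diagonalEntry_monomial, canonicalExpectation_monomial]
  by_cases hg : g = 1 <;> simp [hg]

/-- The canonical expectation is faithful. -/
theorem canonicalExpectation_faithful (hπ : Function.Injective π) {x : ReducedCrossedProduct α π}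
    (hx : canonicalExpectation hπ (star x * x) = 0) : x = 0 := by
  apply toOperator_injective α π
  rw [map_zero]
  refine ext_coordinate fun s h => ?_
  have h0 : diagonalEntry s (toOperator α π (star x * x)) h = 0 := by
    rw [diagonalEntry_eq hπ, hx, map_zero, map_zero, zero_apply]
  -- This inner product equals the squared norm of `x` applied to the coordinate vector.
  have h1 : inner ℂ h ((coordinate H s).adjoint
      (toOperator α π (star x * x) (coordinate H s h))) = 0 := by
    rw [adjoint_coordinate_apply, ← diagonalEntry_apply, h0, inner_zero_right]
  rw [ContinuousLinearMap.adjoint_inner_right, map_mul, map_star,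
    ContinuousLinearMap.star_eq_adjoint, mul_apply_eq_comp,
    ContinuousLinearMap.adjoint_inner_right, inner_self_eq_zero] at h1
  rw [h1, zero_apply]

/-- For a free action, every conditional expectation is the canonical one. -/
theorem IsConditionalExpectation.eq_canonicalExpectation (hπ : Function.Injective π)
    (hfree : ActsFreely α) {E : ReducedCrossedProduct α π →CP A}
    (hE : IsConditionalExpectation (inclusion α π) E) : E = canonicalExpectation hπ := by
  classical
  refine DFunLike.ext _ _ fun x => ?_
  have hE1 : Continuous E := map_continuous E
  have hc : Continuous (canonicalExpectation (α := α) hπ) := map_continuous _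
  refine crossedProduct_induction (p := fun x => E x = canonicalExpectation hπ x)
    (isClosed_eq hE1 hc) (by simp only [map_zero])
    (fun x y hx hy => by simp only [map_add, hx, hy]) (fun g a => ?_) x
  rw [canonicalExpectation_monomial]
  by_cases hg : g = 1
  · rw [if_pos hg, hg, canonicalUnitary_one, mul_one, hE.map_inclusion]
  -- `E(u_g) b = E(u_g b) = E(α_g(b) u_g) = α_g(b) E(u_g)`.
  · have h0 : E (canonicalUnitary α π g) = 0 := hfree g hg _ fun b => by
      rw [← hE.map_mul_inclusion, canonicalUnitary_mul_inclusion, hE.map_inclusion_mul]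
    rw [if_neg hg, hE.map_inclusion_mul, h0, mul_zero]

/-- If the relative commutant of `A` is contained in `A`, then the action is free. -/
theorem actsFreely_of_centralizer_subset (hπ : Function.Injective π)
    (h : Set.centralizer (Set.range (inclusion α π)) ⊆ Set.range (inclusion α π)) :
    ActsFreely α := by
  classical
  intro g hg b hb
  have hE := isConditionalExpectation_canonicalExpectation (α := α) hπ
  set x := canonicalUnitary α π g⁻¹ * inclusion α π b with hx
  have hxc : x ∈ Set.centralizer (Set.range (inclusion α π)) := by
    rintro _ ⟨a, rfl⟩
    rw [hx, mul_assoc, ← map_mul, hb a, map_mul, ← mul_assoc, ← mul_assoc,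
      canonicalUnitary_mul_inclusion, ← StarAlgEquiv.mul_apply, ← map_mul, inv_mul_cancel, map_one]
    rfl
  obtain ⟨c, hcx⟩ := h hxc
  -- `x` is a monomial supported at `g⁻¹ ≠ 1`, whereas `x = ι(c)` has expectation `c`.
  have hEx : canonicalExpectation hπ x = 0 := by
    rw [hx, canonicalUnitary_mul_inclusion, canonicalExpectation_monomial,
      if_neg (inv_ne_one.2 hg)]
  have hc : c = 0 := by rw [← hE.map_inclusion c, hcx, hEx]
  have hx0 : x = 0 := by rw [← hcx, hc, map_zero]
  have hb0 : inclusion α π b = 0 := by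
    have h1 := canonicalUnitary_inv_mul α π g⁻¹
    rw [inv_inv] at h1
    rw [← one_mul (inclusion α π b), ← h1, mul_assoc, ← hx, hx0, mul_zero]
  rw [← hE.map_inclusion b, hb0, map_zero]

end Construction

end CrossedProduct

end

theorem theorem3p2 {A : Type*} [CStarAlgebra A] [PartialOrder A] [StarOrderedRing A]
    {G : Type*} [Group G] (α : G →* (A ≃⋆ₐ[ℂ] A))
    {H : Type*} [NormedAddCommGroup H] [InnerProductSpace ℂ H] [CompleteSpace H]
    (π : A →⋆ₐ[ℂ] (H →L[ℂ] H)) (hπ : Function.Injective π) :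
    List.TFAE [
      ∃! E : CrossedProduct.ReducedCrossedProduct α π →CP A,
        CrossedProduct.IsConditionalExpectation (CrossedProduct.inclusion α π) E,
      Set.centralizer (Set.range (CrossedProduct.inclusion α π)) =
        CrossedProduct.inclusion α π '' Set.center A,
      CrossedProduct.ActsFreely α] := by
  have hE := CrossedProduct.isConditionalExpectation_canonicalExpectation (α := α) hπ
  tfae_have 1 → 2 := fun h => CrossedProduct.centralizer_eq_of_unique hE
    (fun F hF => h.unique hF hE) fun x hx => CrossedProduct.canonicalExpectation_faithful hπ hx
  tfae_have 2 → 3 := fun h => CrossedProduct.actsFreely_of_centralizer_subset hπ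
    (h.trans_subset (Set.image_subset_range _ _))
  tfae_have 3 → 1 := fun h => ⟨_, hE, fun E hE' => hE'.eq_canonicalExpectation hπ h⟩
  tfae_finish
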